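/- Let $k$ be a perfect field of characteristic $p>0$ and let $R$ be a Gorenstein local domain which is essentially of finite type over $k$ (a localization of a finitely generated $k$-algebra). For $e>0$ let $R^{1/p^e}\supseteq R$ be the ring of $p^e$-th roots of elements of $R$, and for an ideal $J\subseteq R$ let $J^{1/p^e}\subseteq R^{1/p^e}$ be the ideal of $p^e$-th roots of elements of $J$. For an $R$-linear map $\varphi:R^{1/p^e}\to R$, the test ideal $\tau(R,\varphi)$ is the smallest nonzero ideal $J\subseteq R$ with $\varphi(J^{1/p^e})\subseteq J$; the (big) test ideal $\tau(R)$ is the smallest nonzero ideal $J\subseteq R$ such that $\varphi(J^{1/p^d})\subseteq J$ for all $d>0$ and all $\varphi\in\operatorname{Hom}_R(R^{1/p^d},R)$. Write $R=T/I$ with $T$ the localization of a polynomial ring $S=k[x_1,\dots,x_n]$ at the set of all polynomials which become units in $R$, and let $d$ be the dimension of the image of $S$ in $R$. The canonical module of $R$ is $\omega_R=\operatorname{Ext}^{\,n-d}_T(R,T)$, and $R$ being Gorenstein means that $\operatorname{Ext}^i_T(R,T)=0$ for $i\ne n-d$ and $\omega_R\cong R$. For $e>0$ let $\Phi_R^e:R^{1/p^e}\to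 R$ be a map dual to the inclusion $R\subseteq R^{1/p^e}$, that is, the composite $$R^{1/p^e}\cong(\omega_R)^{1/p^e}\cong\operatorname{Hom}_R(R^{1/p^e},\omega_R)\to\operatorname{Hom}_R(R,\omega_R)=\omega_R\cong R,$$ where the arrow is restriction along $R\subseteq R^{1/p^e}$, the outer isomorphisms come from an isomorphism $\omega_R\cong R$ of $R$-modules, and the second one is an isomorphism of $R^{1/p^e}$-modules. Then, for every $e>0$, such a map $\Phi_R^e$ exists, and for every choice of it the ideals $\tau(R)$ and $\tau(R,\Phi_R^e)$ exist and $$\tau(R)=\tau(R,\Phi_R^e).$$ -/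

import Mathlib

universe u

open CategoryTheory

/-! ### The ring of `p ^ e`-th roots and its ideals -/

/-- The ring `R^{1/p^e}` of `p ^ e`-th roots of elements of `R`. As a ring it is a copy of `R`, the
element `r` of the copy standing for `r^{1/p^e}` (see `FrobRoot.root`), and it is an `R`-algebra
through the `e`-th iterate of Frobenius (which is the inclusion `R ⊆ R^{1/p^e}`). -/
def FrobRoot (_p _e : ℕ) (R : Type u) : Type u := R

namespace FrobRoot

variable (p e : ℕ) (R : Type u) [CommRing R]

instance : CommRing (FrobRoot p e R) := inferInstanceAs (CommRing R)

/-- The ring isomorphism `R ≃ R^{1/p^e}`, `r ↦ r^{1/p^e}`. -/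
def root : R ≃+* FrobRoot p e R := RingEquiv.refl R

variable [ExpChar R p]

noncomputable instance : Algebra R (FrobRoot p e R) :=
  ((root p e R).toRingHom.comp (iterateFrobenius R p e)).toAlgebra

/-- `(r^{1/p^e})^{p^e} = r` in `R^{1/p^e}`. -/
theorem root_pow (r : R) : root p e R r ^ p ^ e = algebraMap R (FrobRoot p e R) r :=
  (map_pow (root p e R) r (p ^ e)).symm

end FrobRoot

section TestIdeals

variable {p e : ℕ} {R : Type u} [CommRing R] [ExpChar R p]

/-- The ideal `J` is `φ`-compatible: `φ(J^{1/p^e}) ⊆ J`, where `J^{1/p^e}` is the ideal of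
`R^{1/p^e}` generated by (in fact, consisting of) the `p ^ e`-th roots of the elements of `J`. -/
def IsFrobCompatible (φ : FrobRoot p e R →ₗ[R] R) (J : Ideal R) : Prop :=
  ∀ y ∈ J.map (FrobRoot.root p e R), φ y ∈ J

/-- `J` is the test ideal `τ(R, φ)`: the smallest nonzero `φ`-compatible ideal. -/
def IsTestIdealOfMap (φ : FrobRoot p e R →ₗ[R] R) (J : Ideal R) : Prop :=
  IsLeast {I : Ideal R | I ≠ ⊥ ∧ IsFrobCompatible φ I} J

variable (p) in
/-- `J` is the (big) test ideal `τ(R)`: the smallest nonzero ideal which is compatible with all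
`R`-linear maps `R^{1/p^e} → R`, for all `e > 0`. -/
def IsTestIdeal (J : Ideal R) : Prop :=
  IsLeast {I : Ideal R | I ≠ ⊥ ∧
    ∀ e : ℕ, 0 < e → ∀ φ : FrobRoot p e R →ₗ[R] R, IsFrobCompatible φ I} J

end TestIdeals

/-! ### Rings essentially of finite type and their canonical modules -/

/-- A presentation of a `k`-algebra `R` as essentially of finite type: a `k`-algebra map
`f : S = k[x_1, …, x_n] → R` such that every element of `R` is a fraction `f(a) / f(s)`, i.e.
`R` is a localization of the finitely generated `k`-algebra `S / ker f`. -/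
structure EssFinPresentation (k R : Type u) [Field k] [CommRing R] [Algebra k R] where
  /-- the number of variables -/
  n : ℕ
  /-- the map from the polynomial ring -/
  hom : MvPolynomial (Fin n) k →ₐ[k] R
  exists_fraction : ∀ r : R, ∃ a s : MvPolynomial (Fin n) k,
    IsUnit (hom s) ∧ r * hom s = hom a

namespace EssFinPresentation

variable {k R : Type u} [Field k] [CommRing R] [Algebra k R] (P : EssFinPresentation k R)

/-- The multiplicative system of the polynomials which become invertible in `R`. -/
noncomputable def units : Submonoid (MvPolynomial (Fin P.n) k) := (IsUnit.submonoid R).comap P.hom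

/-- The localization `T` of the polynomial ring `S = k[x_1, …, x_n]` at the polynomials which become
invertible in `R`, so that `R` is a quotient of `T`. -/
def Ambient : Type u := Localization P.units

noncomputable instance : CommRing P.Ambient := inferInstanceAs (CommRing (Localization P.units))

noncomputable instance : Algebra (MvPolynomial (Fin P.n) k) P.Ambient :=
  inferInstanceAs (Algebra (MvPolynomial (Fin P.n) k) (Localization P.units))

instance : IsLocalization P.units P.Ambient :=
  inferInstanceAs (IsLocalization P.units (Localization P.units))

/-- The map `T → R` induced by `S → R`. -/
noncomputable def ambientHom : P.Ambient →+* R :=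
  IsLocalization.lift (M := P.units) (g := P.hom.toRingHom) (fun s => s.2)

theorem ambientHom_algebraMap (a : MvPolynomial (Fin P.n) k) :
    P.ambientHom (algebraMap _ P.Ambient a) = P.hom a :=
  IsLocalization.lift_eq (M := P.units) (g := P.hom.toRingHom) (fun s => s.2) a

theorem ambientHom_surjective : Function.Surjective P.ambientHom := by
  intro r
  obtain ⟨a, s, hs, h⟩ := P.exists_fraction r
  refine ⟨IsLocalization.mk' P.Ambient a (⟨s, hs⟩ : P.units), ?_⟩
  apply hs.mul_right_cancel
  rw [h, ← P.ambientHom_algebraMap s, ← map_mul, ← P.ambientHom_algebraMap a]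
  exact congrArg _ (IsLocalization.mk'_spec P.Ambient a (⟨s, hs⟩ : P.units))

/-- `R` as a `T`-algebra. -/
noncomputable instance : Algebra P.Ambient R := P.ambientHom.toAlgebra

/-- The codimension `n - d`, where `d` is the Krull dimension of the finitely generated algebra
`S / ker f` (a natural number `≤ n` when `R` is nonzero). -/
noncomputable def codim : ℕ :=
  P.n - ((ringKrullDim (MvPolynomial (Fin P.n) k ⧸ RingHom.ker P.hom)).unbotD 0).toNat

/-- Multiplication by `r : R`, as a `T`-linear endomorphism of `R`. -/
noncomputable def mulEnd (r : R) : ModuleCat.of P.Ambient R ⟶ ModuleCat.of P.Ambient R :=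
  ModuleCat.ofHom (LinearMap.mulLeft P.Ambient r)

/-- The action of `R` on `Ext^i_T(R, T)` by functoriality in the first variable: `r` acts as the
endomorphism induced by multiplication by `r` on `R`. -/
noncomputable def extAction (i : ℕ) :
    R →+* AddMonoid.End
      (Abelian.Ext.{u} (ModuleCat.of P.Ambient R) (ModuleCat.of P.Ambient P.Ambient) i) where
  toFun r :=
    { toFun := fun x => (Abelian.Ext.mk₀ (P.mulEnd r)).comp x (zero_add i)
      map_zero' := Abelian.Ext.comp_zero _ _ _ _ _
      map_add' := fun _ _ => Abelian.Ext.comp_add _ _ _ _ }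
  map_one' := by
    have h : P.mulEnd 1 = 𝟙 _ := by
      ext; simp [mulEnd]
    ext x
    simp [h]
    rfl
  map_mul' r s := by
    have h : P.mulEnd (r * s) = P.mulEnd r ≫ P.mulEnd s := by
      rw [mul_comm]
      ext; simp [mulEnd]
    ext x
    simp [h, ← Abelian.Ext.mk₀_comp_mk₀_assoc]
    rfl
  map_zero' := by
    have h : P.mulEnd 0 = 0 := by
      ext; simp [mulEnd]
    ext x
    simp [h]
    rfl
  map_add' r s := by
    have h : P.mulEnd (r + s) = P.mulEnd r + P.mulEnd s := by
      ext; simp [mulEnd, add_mul]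
    ext x
    simp [h, Abelian.Ext.mk₀_add, Abelian.Ext.add_comp]
    rfl

/-- The module `Ext^i_T(R, T)`; this is the localization of `Ext^i_S(S / ker f, S)`. -/
def ExtAmbient (i : ℕ) : Type u :=
  Abelian.Ext.{u} (ModuleCat.of P.Ambient R) (ModuleCat.of P.Ambient P.Ambient) i

noncomputable instance (i : ℕ) : AddCommGroup (P.ExtAmbient i) :=
  inferInstanceAs (AddCommGroup (Abelian.Ext.{u} _ _ i))

/-- The `R`-module structure of `Ext^i_T(R, T)`, given by `extAction`. -/
noncomputable instance (i : ℕ) : Module R (P.ExtAmbient i) :=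
  Module.compHom
    (Abelian.Ext.{u} (ModuleCat.of P.Ambient R) (ModuleCat.of P.Ambient P.Ambient) i)
    (P.extAction i)

/-- The canonical module `ω_R = Ext^{n-d}_T(R, T)`. -/
abbrev CanonicalModule : Type u := P.ExtAmbient P.codim

/-- The local ring `R` is Cohen-Macaulay: `Ext^i_T(R, T) = 0` for all `i ≠ n - d`. -/
def IsCohenMacaulayLocal [IsLocalRing R] : Prop :=
  ∀ i : ℕ, i ≠ P.codim → Subsingleton (P.ExtAmbient i)

/-- The local ring `R` is Gorenstein: it is Cohen-Macaulay and `ω_R ≅ R`. -/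
def IsGorensteinLocal [IsLocalRing R] : Prop :=
  P.IsCohenMacaulayLocal ∧ Nonempty (P.CanonicalModule ≃ₗ[R] R)

/-- `Φ : R^{1/p^e} → R` is a map `Φ_R^e`, dual to the inclusion `R ⊆ R^{1/p^e}`: it is the composite
`R^{1/p^e} ≅ (ω_R)^{1/p^e} ≅ Hom_R(R^{1/p^e}, ω_R) → Hom_R(R, ω_R) = ω_R ≅ R`
for some isomorphism `u : ω_R ≅ R` of `R`-modules (used at both ends) and some isomorphism
`δ : (ω_R)^{1/p^e} ≅ Hom_R(R^{1/p^e}, ω_R)` of `R^{1/p^e}`-modules. Here `(ω_R)^{1/p^e}` is `ω_R`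
with `r^{1/p^e}` acting as `r`, and `R^{1/p^e}` acts on `Hom_R(R^{1/p^e}, ω_R)` through the
argument; the arrow is the restriction along `R ⊆ R^{1/p^e}`, i.e. evaluation at `1`. -/
def IsFrobeniusDual {p e : ℕ} [ExpChar R p] (Φ : FrobRoot p e R →ₗ[R] R) : Prop :=
  ∃ (u : P.CanonicalModule ≃ₗ[R] R)
    (δ : P.CanonicalModule ≃+ (FrobRoot p e R →ₗ[R] P.CanonicalModule)),
    (∀ (r : R) (w : P.CanonicalModule) (y : FrobRoot p e R),
      δ (r • w) y = δ w (FrobRoot.root p e R r * y)) ∧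
    ∀ x : R, Φ (FrobRoot.root p e R x) = u (δ (u.symm x) 1)

end EssFinPresentation

/-! Write q = p^e. The key fact is that `Hom(R^{1/q}, R)` is free of rank one over `R^{1/q}`,
generated by the dual Φ of Frobenius; for an ideal, being Φ-compatible is then the same as being
compatible with all maps of level e.

Existence of Φ is duality for Frobenius on T. Over a perfect field the polynomial ring has an
explicit trace with dual generating systems, and it localizes to T. Let c = n - d and I = ker(T →
R). Vanishing of `Ext^i_T(R, T)` for i < c gives a T-regular sequence of length c in I, generating
J; its q-th powers are again regular since Frobenius is flat. So ω_R is the I-torsion both of T/J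
and of T/J^{[q]}. Every map `T^{1/q} → T/J` is tr(h ·) with h unique modulo J^{[q]}, and it factors
through `R^{1/q}` exactly when h is I-torsion modulo J^{[q]}. This is
`FrobeniusTrace.exists_addEquiv_linearMap`.

For the test ideals, composites of generators are generators (`IsFrobGenerator.mul`). The smallest
Φ-compatible ideal τ exists because one power of a fixed nonzero element lies in every nonzero
compatible ideal (`IsFrobGenerator.exists_isLeast`). Let Ψ generate level d. Since ΦΨ and ΨΦ have
the same level, Φ(Ψ(τ)) ⊆ Ψ(Φ(τ)) ⊆ Ψ(τ), so τ ⊆ Ψ(τ) by minimality. Iterating, Ψ(τ) ⊆ Ψ^e(τ) ⊆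
Φ^d(τ) ⊆ τ, because Ψ^e and Φ^d both have level de. So τ is compatible with every level
(`IsFrobGenerator.mem_of_isLeast`). -/

/-! ### Ext and regular sequences -/

section ExtRegular

open Abelian RingTheory.Sequence Pointwise

variable {T : Type u} [CommRing T]

/-- Elements annihilating `N` annihilate `Ext^n(N, M)`. -/
theorem smul_ext_eq_zero_of_mem_annihilator {N M : ModuleCat.{u} T} {r : T}
    (hr : r ∈ Module.annihilator T N) {n : ℕ} (x : Ext.{u} N M n) : r • x = 0 := by
  have h0 : r • 𝟙 N = 0 := by
    simp [← ModuleCat.lsmul_eq_smul_id, Module.mem_annihilator_iff_lsmul_eq_zero.mp hr]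
  have h1 : r • x = (Ext.mk₀ (r • 𝟙 N)).comp x (zero_add n) := by simp [Ext.mk₀_smul]
  rw [h1, h0]; simp

/-- If `r` annihilates `N` and is regular on `M`, every element of `Ext^{n+1}(N, M)` comes from
`Ext^n(N, M / rM)` by the connecting homomorphism. -/
theorem exists_comp_extClass_eq {N M : ModuleCat.{u} T} {r : T}
    (hr : r ∈ Module.annihilator T N) (reg : IsSMulRegular M r) {n : ℕ}
    (x : Ext.{u} N M (n + 1)) :
    ∃ y : Ext.{u} N (ModuleCat.of T (QuotSMulTop r M)) n,
      y.comp reg.smulShortComplex_shortExact.extClass rfl = x := by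
  refine Ext.covariant_sequence_exact₁ N reg.smulShortComplex_shortExact x ?_ rfl
  rw [ModuleCat.smulShortComplex_f_eq_smul_id]
  exact (Ext.smul_eq_comp_mk₀ x r).symm.trans (smul_ext_eq_zero_of_mem_annihilator hr x)

/-- Each element of the sequence kills Ext but is regular on the module at its stage, so connecting
maps lower the degree until a Hom group is reached. That group vanishes: its source is killed by an
element regular on its target. -/
theorem subsingleton_ext_of_isWeaklyRegular (N : ModuleCat.{u} T) (M : Type u) [AddCommGroup M]
    [Module T M] (rs : List T) (hrs : ∀ r ∈ rs, r ∈ Module.annihilator T N)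
    (reg : IsWeaklyRegular M rs) (i : ℕ) (hi : i < rs.length) :
    Subsingleton (Ext.{u} N (ModuleCat.of T M) i) := by
  induction rs generalizing M i with
  | nil => simp at hi
  | cons r rs ih =>
    rw [isWeaklyRegular_cons_iff] at reg
    have hr : r ∈ Module.annihilator T N := hrs r List.mem_cons_self
    cases i with
    | zero =>
      have := reg.1.linearMap_subsingleton_of_mem_annihilator hr
      exact (Ext.addEquiv₀.trans ModuleCat.homAddEquiv).subsingleton
    | succ n =>
      have := ih (QuotSMulTop r M) (fun s hs => hrs s (List.mem_cons_of_mem _ hs)) reg.2 n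
        (by simpa using hi)
      refine ⟨fun x x' => ?_⟩
      have reg1 : IsSMulRegular (ModuleCat.of T M) r := reg.1
      obtain ⟨y, rfl⟩ := exists_comp_extClass_eq hr reg1 x
      obtain ⟨y', rfl⟩ := exists_comp_extClass_eq hr reg1 x'
      have : y = y' := this.elim _ _
      rw [this]

/-- If `rs` is a weakly `M`-regular sequence in the kernel of the surjection `T → R`, then
`Ext^n_T(R, M)`, where `n` is the length of `rs`, is the submodule of `M / (rs) M` annihilated by
this kernel. -/
theorem exists_ext_linearMap_of_isWeaklyRegular {R : Type u} [CommRing R] [Algebra T R]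
    (hs : Function.Surjective (algebraMap T R)) (M : Type u) [AddCommGroup M]
    [Module T M] (rs : List T) (hrs : ∀ r ∈ rs, r ∈ RingHom.ker (algebraMap T R))
    (reg : IsWeaklyRegular M rs) :
    ∃ α : Ext.{u} (ModuleCat.of T R) (ModuleCat.of T M) rs.length →ₗ[T]
        M ⧸ (Ideal.ofList rs • ⊤ : Submodule T M),
      Function.Injective α ∧
      ∀ m, (∀ i ∈ RingHom.ker (algebraMap T R), i • m = 0) → m ∈ Set.range α := by
  have hann : ∀ r ∈ RingHom.ker (algebraMap T R), r ∈ Module.annihilator T R := by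
    intro r hr
    rw [Module.mem_annihilator]
    intro x
    rw [Algebra.smul_def, (RingHom.mem_ker).1 hr, zero_mul]
  induction rs generalizing M with
  -- Evaluation at 1 identifies `Hom_T(R, M)` with the torsion of `M` under the kernel.
  | nil =>
    have hbot : (Ideal.ofList ([] : List T) • ⊤ : Submodule T M) = ⊥ := by simp
    let e := (Submodule.quotEquivOfEqBot _ hbot).symm
    let ev : (R →ₗ[T] M) →ₗ[T] M := LinearMap.applyₗ (1 : R)
    have hev : Function.Injective ev := by
      intro f g hfg
      ext x
      obtain ⟨t, rfl⟩ := hs x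
      have h1 : f 1 = g 1 := hfg
      rw [Algebra.algebraMap_eq_smul_one, map_smul, map_smul, h1]
    let E : Ext.{u} (ModuleCat.of T R) (ModuleCat.of T M) 0 ≃ₗ[T] (R →ₗ[T] M) :=
      Ext.linearEquiv₀.trans ModuleCat.homLinearEquiv
    refine ⟨e.toLinearMap ∘ₗ ev ∘ₗ E.toLinearMap, ?_, ?_⟩
    · exact e.injective.comp (hev.comp E.injective)
    · intro m hm
      have hm' : ∀ i ∈ RingHom.ker (algebraMap T R), i • e.symm m = 0 := by
        intro i hi
        rw [← map_smul, hm i hi, map_zero]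
      have hf0 : ∀ t, Function.surjInv hs (algebraMap T R t) • e.symm m = t • e.symm m := by
        intro t
        rw [← sub_eq_zero, ← sub_smul]
        apply hm'
        rw [RingHom.mem_ker, map_sub, Function.surjInv_eq hs, sub_self]
      let f : R →ₗ[T] M :=
        { toFun := fun x => Function.surjInv hs x • e.symm m
          map_add' := by
            intro x y
            obtain ⟨s, rfl⟩ := hs x
            obtain ⟨t, rfl⟩ := hs y
            rw [← map_add, hf0, hf0, hf0, add_smul]
          map_smul' := by
            intro t x
            obtain ⟨s, rfl⟩ := hs x
            rw [Algebra.smul_def, ← map_mul, hf0, hf0, mul_smul, RingHom.id_apply] }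
      refine ⟨E.symm f, ?_⟩
      have h1 : f 1 = e.symm m := by
        have := hf0 1
        rwa [map_one, one_smul] at this
      simp [ev, h1]
  | cons r rs ih =>
    rw [isWeaklyRegular_cons_iff] at reg
    have hr : r ∈ Module.annihilator T R := hann r (hrs r List.mem_cons_self)
    have hrs' : ∀ s ∈ rs, s ∈ RingHom.ker (algebraMap T R) :=
      fun s hs => hrs s (List.mem_cons_of_mem _ hs)
    obtain ⟨α, hα, hα'⟩ := ih (QuotSMulTop r M) hrs' reg.2
    -- The sequence is one longer than this degree, so the term before the connecting map vanishes;
    -- this makes `δ` injective.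
    have hsub : Subsingleton (Ext.{u} (ModuleCat.of T R) (ModuleCat.of T M) rs.length) :=
      subsingleton_ext_of_isWeaklyRegular _ M (r :: rs) (fun s hs => hann s (hrs s hs))
        ((isWeaklyRegular_cons_iff M r rs).2 reg) _ (by simp)
    have reg1 : IsSMulRegular (ModuleCat.of T M) r := reg.1
    let δ : Ext.{u} (ModuleCat.of T R) (ModuleCat.of T (QuotSMulTop r M)) rs.length →ₗ[T]
        Ext.{u} (ModuleCat.of T R) (ModuleCat.of T M) (rs.length + 1) :=
      { toFun := fun x => x.comp reg1.smulShortComplex_shortExact.extClass rfl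
        map_add' := fun x y => Ext.add_comp _ _ _ _
        map_smul' := fun t x => Ext.smul_comp _ _ _ _ }
    have hδ : Function.Bijective δ := by
      refine ⟨?_, fun x => exists_comp_extClass_eq hr reg1 x⟩
      rw [injective_iff_map_eq_zero]
      intro x hx
      obtain ⟨y, rfl⟩ := Ext.covariant_sequence_exact₃ (ModuleCat.of T R)
        reg1.smulShortComplex_shortExact x rfl hx
      rw [show y = 0 from hsub.elim _ _, Ext.zero_comp]
      rfl
    let D := LinearEquiv.ofBijective δ hδ
    let e := Submodule.quotOfListConsSMulTopEquivQuotSMulTopInner M r rs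
    refine ⟨e.symm.toLinearMap ∘ₗ α ∘ₗ D.symm.toLinearMap, ?_, ?_⟩
    · exact e.symm.injective.comp (hα.comp D.symm.injective)
    · intro m hm
      obtain ⟨w, hw⟩ := hα' (e m) (fun i hi => by rw [← map_smul, hm i hi, map_zero])
      exact ⟨D w, by simp [hw]⟩

end ExtRegular

/-! ### Traces of Frobenius -/

/-- An additive map `tr : A → A` with `tr (g ^ q * f) = g * tr f`, together with finite families
`x`, `y` which form dual generating systems of `A` over `A ^ q` for `tr`. When `q` is a power of the
characteristic, this exhibits `Hom_A(A^{1/q}, A)` as generated by `tr`. -/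
structure FrobeniusTrace (q : ℕ) (A : Type u) [CommRing A] where
  /-- the underlying additive map -/
  tr : A →+ A
  tr_pow_mul : ∀ g f, tr (g ^ q * f) = g * tr f
  /-- the index set of the dual generating systems -/
  ι : Type
  [fintype : Fintype ι]
  /-- the generating system -/
  x : ι → A
  /-- the dual system -/
  y : ι → A
  sum_eq : ∀ f, ∑ i, tr (f * y i) ^ q * x i = f

namespace FrobeniusTrace

attribute [instance] FrobeniusTrace.fintype

section Polynomial

open MvPolynomial

variable (p e n : ℕ) (k : Type u) [Field k] [ExpChar k p] [PerfectRing k p]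

/-- The coefficientwise `q`-th root of the monomials whose exponents are all `≡ -1` modulo `q`,
divided by the product of the variables. -/
noncomputable def polyTrFun (m : Fin n →₀ ℕ) : k →+ MvPolynomial (Fin n) k :=
  haveI := Classical.propDecidable
  if ∀ i, p ^ e ∣ m i + 1 then
    (monomial (m.mapRange (fun j => (j + 1) / p ^ e - 1)
      -- `mapRange` requires 0 ↦ 0. For `p ^ e > 1` this holds by truncated subtraction, and a zero
      -- exponent never meets the divisibility condition.
      (by rcases Nat.lt_or_ge 1 (p ^ e) with h | h
          · simp [Nat.div_eq_of_lt h]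
          · have := Nat.le_of_lt_succ (Nat.lt_succ_of_le h)
            interval_cases p ^ e <;> rfl))).toAddMonoidHom.comp
      ((iterateFrobeniusEquiv k p e).symm : k →+ k)
  else 0

/-- The trace of Frobenius on a polynomial ring. -/
noncomputable def polyTr : MvPolynomial (Fin n) k →+ MvPolynomial (Fin n) k :=
  (Finsupp.liftAddHom (polyTrFun p e n k)).comp
    (AddMonoidAlgebra.coeffAddEquiv (R := k) (M := Fin n →₀ ℕ)).toAddMonoidHom

theorem polyTr_monomial (m : Fin n →₀ ℕ) (c : k) :
    polyTr p e n k (monomial m c) = polyTrFun p e n k m c := by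
  change Finsupp.liftAddHom (polyTrFun p e n k) (Finsupp.single m c) = _
  simp

theorem polyTr_monomial_of_forall_dvd {m l : Fin n →₀ ℕ}
    (h : ∀ i, m i + 1 = p ^ e * (l i + 1)) (c : k) :
    polyTr p e n k (monomial m c) = monomial l ((iterateFrobeniusEquiv k p e).symm c) := by
  have hq : 0 < p ^ e := pow_pos (expChar_pos k p) e
  rw [polyTr_monomial, polyTrFun, if_pos (fun i => ⟨_, h i⟩)]
  change monomial _ _ = _
  refine congrArg (fun l => monomial l _) (Finsupp.ext fun i => ?_)
  simp [h, hq]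

theorem polyTr_monomial_of_not_dvd {m : Fin n →₀ ℕ} {i : Fin n}
    (h : ¬ p ^ e ∣ m i + 1) (c : k) : polyTr p e n k (monomial m c) = 0 := by
  rw [polyTr_monomial, polyTrFun, if_neg (fun h' => h (h' i))]
  rfl

theorem polyTr_pow_mul (g f : MvPolynomial (Fin n) k) :
    polyTr p e n k (g ^ p ^ e * f) = g * polyTr p e n k f := by
  have hq : 0 < p ^ e := pow_pos (expChar_pos k p) e
  have : ExpChar (MvPolynomial (Fin n) k) p := expChar_of_injective_algebraMap
    (MvPolynomial.C_injective (Fin n) k) p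
  induction f using MvPolynomial.induction_on' with
  | add f f' hf hf' => rw [mul_add, map_add, hf, hf', map_add, mul_add]
  | monomial m c =>
    induction g using MvPolynomial.induction_on' with
    | add g g' hg hg' =>
      rw [add_pow_expChar_pow, add_mul, map_add, hg, hg', add_mul]
    | monomial l d =>
      rw [monomial_pow, monomial_mul]
      by_cases h : ∀ i, p ^ e ∣ m i + 1
      · choose a ha using h
        have ha1 : ∀ i, a i = a i - 1 + 1 := by
          intro i
          have : a i ≠ 0 := by
            intro h0
            have := ha i
            rw [h0] at this
            omega
          omega
        let a' : Fin n →₀ ℕ := Finsupp.equivFunOnFinite.symm (fun i => a i - 1)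
        rw [polyTr_monomial_of_forall_dvd p e n k (m := m) (l := a')
          (fun i => by rw [ha i]; congr 1; exact ha1 i)]
        rw [polyTr_monomial_of_forall_dvd p e n k (l := l + a'), monomial_mul, map_mul]
        · congr 2
          rw [RingEquiv.symm_apply_eq]; rfl
        · intro i
          have h1 := ha i
          rw [ha1 i] at h1
          simp only [Finsupp.coe_add, Finsupp.coe_smul, Pi.add_apply, Pi.smul_apply, smul_eq_mul,
            a', Finsupp.equivFunOnFinite_symm_apply_apply]
          rw [add_assoc, h1]; ring
      -- Adding multiples of `p ^ e` to the exponents does not change the residue that fails, so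
      -- both sides vanish.
      · push Not at h
        obtain ⟨i, hi⟩ := h
        rw [polyTr_monomial_of_not_dvd p e n k hi, mul_zero]
        refine polyTr_monomial_of_not_dvd p e n k (i := i) ?_ _
        simpa [add_assoc, Nat.dvd_add_right] using hi

/-- The trace of Frobenius on a polynomial ring over a perfect field. -/
noncomputable def mvPolynomial : FrobeniusTrace (p ^ e) (MvPolynomial (Fin n) k) where
  tr := polyTr p e n k
  tr_pow_mul := polyTr_pow_mul p e n k
  ι := Fin n → Fin (p ^ e)
  x b := monomial (Finsupp.equivFunOnFinite.symm (fun i => (b i : ℕ))) 1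
  y b := monomial (Finsupp.equivFunOnFinite.symm (fun i => p ^ e - 1 - (b i : ℕ))) 1
  sum_eq f := by
    have hq : 0 < p ^ e := pow_pos (expChar_pos k p) e
    have : ExpChar (MvPolynomial (Fin n) k) p := expChar_of_injective_algebraMap
      (MvPolynomial.C_injective (Fin n) k) p
    induction f using MvPolynomial.induction_on' with
    | add f f' hf hf' =>
      simp only [add_mul, map_add, add_pow_expChar_pow, Finset.sum_add_distrib, hf, hf']
    | monomial m c =>
      -- Only the index of residues of `m` survives: the exponent m_i + (q - 1 - b_i) is ≡ -1 modulo
      -- q just when b_i ≡ m_i.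
      let b0 : Fin n → Fin (p ^ e) := fun i => ⟨m i % p ^ e, Nat.mod_lt _ hq⟩
      rw [Finset.sum_eq_single b0]
      · rw [monomial_mul, polyTr_monomial_of_forall_dvd p e n k
          (l := Finsupp.equivFunOnFinite.symm (fun i => m i / p ^ e)), monomial_pow, monomial_mul]
        · rw [mul_one, mul_one, ← iterateFrobeniusEquiv_def, RingEquiv.apply_symm_apply]
          refine congrArg (fun l => monomial l c) (Finsupp.ext fun i => ?_)
          simp [b0, Nat.div_add_mod]
        · intro i
          have h1 := Nat.div_add_mod (m i) (p ^ e)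
          have h2 := Nat.mod_lt (m i) hq
          simp only [Finsupp.coe_add, Pi.add_apply, Finsupp.equivFunOnFinite_symm_apply_apply, b0,
            mul_add, mul_one]
          omega
      · intro b _ hb
        obtain ⟨i, hi⟩ := Function.ne_iff.1 hb
        rw [monomial_mul, polyTr_monomial_of_not_dvd p e n k (i := i),
          zero_pow hq.ne', zero_mul]
        intro hdvd
        apply hi
        ext
        simp only [Finsupp.coe_add, Pi.add_apply, Finsupp.equivFunOnFinite_symm_apply_apply] at hdvd
        have h1 := (b i).2
        have h2 : m i + (p ^ e - 1 - (b i : ℕ)) + 1 + b i = m i + p ^ e := by omega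
        have h3 : (m i + p ^ e) % p ^ e = ((b i : ℕ)) % p ^ e := by
          rw [← h2, Nat.add_mod, Nat.mod_eq_zero_of_dvd hdvd, zero_add, Nat.mod_mod]
        rw [Nat.add_mod_right, Nat.mod_eq_of_lt h1] at h3
        exact h3.symm
      · simp

end Polynomial

/-! ### Localizing a trace -/

section Localization

variable {q : ℕ} {A : Type u} [CommRing A] (𝒯 : FrobeniusTrace q A) (M : Submonoid A)
  (B : Type u) [CommRing B] [Algebra A B] [IsLocalization M B]

/-- The trace on a localization, as a function. -/
noncomputable def locTr (b : B) : B :=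
  IsLocalization.mk' B
    (𝒯.tr ((IsLocalization.sec M b).1 * ((IsLocalization.sec M b).2 : A) ^ (q - 1)))
    (IsLocalization.sec M b).2

/-- The formula is forced by a/s = a s^{q-1} / s^q. Independence of the fraction follows by moving
the denominators, and the element witnessing equality of fractions, into the trace as q-th powers.
-/
theorem locTr_mk' (hq : q ≠ 0) (a : A) (s : M) :
    𝒯.locTr M B (IsLocalization.mk' B a s) =
      IsLocalization.mk' B (𝒯.tr (a * (s : A) ^ (q - 1))) s := by
  rw [locTr]
  set z := IsLocalization.sec M (IsLocalization.mk' B a s) with hz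
  have h0 : IsLocalization.mk' B z.1 z.2 = IsLocalization.mk' B a s := IsLocalization.mk'_sec ..
  obtain ⟨q, rfl⟩ := Nat.exists_eq_add_one_of_ne_zero hq
  simp only [Nat.add_sub_cancel]
  rw [IsLocalization.eq] at h0 ⊢
  obtain ⟨c, hc⟩ := h0
  refine ⟨c, ?_⟩
  rw [← mul_assoc, ← mul_assoc, ← 𝒯.tr_pow_mul, ← 𝒯.tr_pow_mul]
  congr 1
  calc _ = (c : A) ^ q * (s : A) ^ q * (z.2 : A) ^ q * (c * (s * z.1)) := by ring
    _ = _ := by rw [hc]; ring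

/-- The trace on a localization. -/
noncomputable def localization (hq : q ≠ 0) : FrobeniusTrace q B where
  tr := AddMonoidHom.mk' (𝒯.locTr M B) (by
    intro f g
    obtain ⟨a, s, rfl⟩ := IsLocalization.exists_mk'_eq M f
    obtain ⟨b, t, rfl⟩ := IsLocalization.exists_mk'_eq M g
    have hf : IsLocalization.mk' B a s = IsLocalization.mk' B (a * t) (s * t) :=
      (IsLocalization.mk'_cancel a s t).symm
    have hg : IsLocalization.mk' B b t = IsLocalization.mk' B (b * s) (s * t) := by
      rw [mul_comm s t, IsLocalization.mk'_cancel]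
    rw [← IsLocalization.mk'_add, hf, hg, locTr_mk' _ _ _ hq, locTr_mk' _ _ _ hq,
      locTr_mk' _ _ _ hq, add_mul, map_add, IsLocalization.mk'_eq_mul_mk'_one, map_add, add_mul,
      ← IsLocalization.mk'_eq_mul_mk'_one, ← IsLocalization.mk'_eq_mul_mk'_one])
  tr_pow_mul := by
    intro g f
    obtain ⟨a, s, rfl⟩ := IsLocalization.exists_mk'_eq M f
    obtain ⟨c, t, rfl⟩ := IsLocalization.exists_mk'_eq M g
    change 𝒯.locTr M B _ = _ * 𝒯.locTr M B _
    rw [← IsLocalization.mk'_pow, ← IsLocalization.mk'_mul, locTr_mk' _ _ _ hq,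
      locTr_mk' _ _ _ hq, ← IsLocalization.mk'_mul]
    obtain ⟨q, rfl⟩ := Nat.exists_eq_add_one_of_ne_zero hq
    have : c ^ (q + 1) * a * ((t ^ (q + 1) * s : M) : A) ^ q
        = (c * t ^ q) ^ (q + 1) * (a * s ^ q) := by
      push_cast; ring
    simp only [Nat.add_sub_cancel]
    rw [this, 𝒯.tr_pow_mul, IsLocalization.mk'_eq_iff_eq]
    congr 1
    push_cast
    ring
  ι := 𝒯.ι
  x i := algebraMap A B (𝒯.x i)
  y i := algebraMap A B (𝒯.y i)
  sum_eq f := by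
    obtain ⟨a, s, rfl⟩ := IsLocalization.exists_mk'_eq M f
    have h : ∀ i, 𝒯.locTr M B (IsLocalization.mk' B a s * algebraMap A B (𝒯.y i)) ^ q *
        algebraMap A B (𝒯.x i) = algebraMap A B (𝒯.tr (a * (s : A) ^ (q - 1) * 𝒯.y i) ^ q * 𝒯.x i) *
          IsLocalization.mk' B 1 (s ^ q) := by
      intro i
      rw [mul_comm, mul_comm (IsLocalization.mk' B a s), IsLocalization.mul_mk'_eq_mk'_of_mul,
        locTr_mk' _ _ _ hq, ← IsLocalization.mk'_pow, IsLocalization.mul_mk'_eq_mk'_of_mul,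
        IsLocalization.mk'_eq_mul_mk'_one, mul_comm (𝒯.x i), mul_comm (𝒯.y i), mul_right_comm]
    change ∑ i, 𝒯.locTr M B _ ^ _ * _ = _
    rw [Finset.sum_congr rfl (fun i _ => h i), ← Finset.sum_mul, ← map_sum, 𝒯.sum_eq,
      ← IsLocalization.mk'_eq_mul_mk'_one]
    obtain ⟨q, rfl⟩ := Nat.exists_eq_add_one_of_ne_zero hq
    rw [Nat.add_sub_cancel, pow_succ', ← SubmonoidClass.coe_pow, IsLocalization.mk'_cancel]

end Localization

end FrobeniusTrace

/-! ### Duality for Frobenius on a quotient -/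

theorem FrobRoot.smul_root {p e : ℕ} {R : Type u} [CommRing R] [ExpChar R p] (r y : R) :
    r • FrobRoot.root p e R y = FrobRoot.root p e R (r ^ p ^ e * y) := by
  rw [Algebra.smul_def, ← FrobRoot.root_pow, map_mul, map_pow]

namespace FrobeniusTrace

variable {q p e : ℕ} {A : Type u} [CommRing A]

/-- Expanding f = ∑ tr(f y_i)^q x_i shows that φ is determined by the values φ(x_i). With lifts c_i
of these, h = ∑ c_i^q y_i works. -/
theorem exists_eq_mk_tr (𝒯 : FrobeniusTrace q A) (J : Ideal A) (φ : A →+ A ⧸ J)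
    (hφ : ∀ t f, φ (t ^ q * f) = t • φ f) :
    ∃ h, ∀ f, φ f = Ideal.Quotient.mk J (𝒯.tr (h * f)) := by
  choose c hc using fun i => Ideal.Quotient.mk_surjective (φ (𝒯.x i))
  refine ⟨∑ i, c i ^ q * 𝒯.y i, fun f => ?_⟩
  have h1 : 𝒯.tr ((∑ i, c i ^ q * 𝒯.y i) * f) = ∑ i, 𝒯.tr (f * 𝒯.y i) * c i := by
    rw [Finset.sum_mul, map_sum]
    refine Finset.sum_congr rfl fun i _ => ?_
    rw [mul_assoc, 𝒯.tr_pow_mul, mul_comm f, mul_comm]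
  rw [h1, map_sum]
  conv_lhs => rw [← 𝒯.sum_eq f]
  rw [map_sum]
  refine Finset.sum_congr rfl fun i _ => ?_
  rw [hφ, ← hc, (Ideal.Quotient.mk J).map_mul]
  rfl

/-- Quotients of rings with a trace are `F`-finite. -/
theorem finite_frobRoot_of_surjective (𝒯 : FrobeniusTrace (p ^ e) A) {R : Type u} [CommRing R]
    [ExpChar R p] (π : A →+* R) (hπ : Function.Surjective π) :
    Module.Finite R (FrobRoot p e R) := by
  refine Module.finite_def.2 (Submodule.fg_def.2
    ⟨Set.range (fun j => FrobRoot.root p e R (π (𝒯.x j))), Set.finite_range _, ?_⟩)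
  rw [eq_top_iff]
  rintro f -
  obtain ⟨f, rfl⟩ := (FrobRoot.root p e R).surjective f
  obtain ⟨f, rfl⟩ := hπ f
  rw [← 𝒯.sum_eq f, map_sum, map_sum]
  refine Submodule.sum_mem _ fun j _ => ?_
  rw [map_mul, map_pow, ← FrobRoot.smul_root]
  exact Submodule.smul_mem _ _ (Submodule.subset_span ⟨j, rfl⟩)

variable [ExpChar A p]

/-- Together with `tr_mem_of_mem_map`, this says that tr(h ·) vanishes modulo J exactly when h ∈
J^{[q]}. -/
theorem mem_map_of_tr_mem (𝒯 : FrobeniusTrace (p ^ e) A) {J : Ideal A} {h : A}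
    (hh : ∀ f, 𝒯.tr (h * f) ∈ J) : h ∈ J.map (iterateFrobenius A p e) := by
  rw [← 𝒯.sum_eq h]
  refine Ideal.sum_mem _ fun i _ => Ideal.mul_mem_right _ _ ?_
  exact Ideal.mem_map_of_mem (iterateFrobenius A p e) (hh (𝒯.y i))

theorem tr_mem_of_mem_map (𝒯 : FrobeniusTrace (p ^ e) A) {J : Ideal A} {h : A}
    (hh : h ∈ J.map (iterateFrobenius A p e)) : 𝒯.tr h ∈ J := by
  induction hh using Submodule.span_induction with
  | mem x hx =>
    obtain ⟨j, hj, rfl⟩ := hx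
    have := 𝒯.tr_pow_mul j 1
    rw [mul_one] at this
    rw [iterateFrobenius_def, this]
    exact J.mul_mem_right _ hj
  | zero => simp
  | add x y _ _ hx hy => rw [map_add]; exact J.add_mem hx hy
  | smul a x hx' hx =>
    -- The trace of `x` says nothing about that of `a * x`, so the induction is redone for all
    -- multipliers at once.
    clear hx
    revert a
    induction hx' using Submodule.span_induction with
    | mem x hx =>
      obtain ⟨j, hj, rfl⟩ := hx
      intro a
      rw [smul_eq_mul, mul_comm, iterateFrobenius_def, 𝒯.tr_pow_mul]
      exact J.mul_mem_right _ hj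
    | zero => simp
    | add x y _ _ hx hy => intro a; rw [smul_add, map_add]; exact J.add_mem (hx a) (hy a)
    | smul b x _ hx => intro a; rw [← mul_smul]; exact hx _

/-- A trace makes Frobenius flat. -/
theorem flat_frobRoot (𝒯 : FrobeniusTrace (p ^ e) A) : Module.Flat A (FrobRoot p e A) := by
  -- The dual systems exhibit A^{1/q} as a retract of a finite free module.
  let i : FrobRoot p e A →ₗ[A] (𝒯.ι → A) :=
    { toFun := fun f j => 𝒯.tr ((FrobRoot.root p e A).symm f * 𝒯.y j)
      map_add' := fun f g => by ext j; simp [add_mul]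
      map_smul' := fun a f => by
        ext j
        obtain ⟨f, rfl⟩ := (FrobRoot.root p e A).surjective f
        rw [FrobRoot.smul_root, RingEquiv.symm_apply_apply, mul_assoc, 𝒯.tr_pow_mul]
        simp }
  let r : (𝒯.ι → A) →ₗ[A] FrobRoot p e A :=
    ∑ j, (LinearMap.toSpanSingleton A (FrobRoot p e A) (FrobRoot.root p e A (𝒯.x j))).comp
      (LinearMap.proj j)
  refine Module.Flat.of_retract i r ?_
  ext f
  obtain ⟨f, rfl⟩ := (FrobRoot.root p e A).surjective f
  simp only [r, i, LinearMap.comp_apply, LinearMap.sum_apply, LinearMap.proj_apply,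
    LinearMap.toSpanSingleton_apply, LinearMap.coe_mk, AddHom.coe_mk, LinearMap.id_apply,
    FrobRoot.smul_root, RingEquiv.symm_apply_apply]
  rw [← map_sum, 𝒯.sum_eq]

theorem isWeaklyRegular_map_iterateFrobenius (𝒯 : FrobeniusTrace (p ^ e) A) {rs : List A}
    (reg : RingTheory.Sequence.IsWeaklyRegular A rs) :
    RingTheory.Sequence.IsWeaklyRegular A (rs.map (iterateFrobenius A p e)) := by
  have := 𝒯.flat_frobRoot
  exact reg.of_flat (S := FrobRoot p e A)

/-- Grothendieck duality for Frobenius on a quotient `R` of `A`: if `ω` is both the part of `A / J`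
and the part of `A / J^{[q]}` annihilated by the kernel of `A → R`, then
`ω^{1/q} ≅ Hom_R(R^{1/q}, ω)`. -/
theorem exists_addEquiv_linearMap (𝒯 : FrobeniusTrace (p ^ e) A) {R : Type u} [CommRing R]
    [ExpChar R p] (π : A →+* R) (hπ : Function.Surjective π) (J : Ideal A)
    {ω : Type u} [AddCommGroup ω] [Module R ω]
    (α : ω →+ A ⧸ J) (hα : Function.Injective α) (hα_smul : ∀ t w, α (π t • w) = t • α w)
    (hα_range : ∀ m, (∀ i ∈ RingHom.ker π, i • m = 0) → m ∈ Set.range α)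
    (β : ω →+ A ⧸ J.map (iterateFrobenius A p e)) (hβ : Function.Injective β)
    (hβ_smul : ∀ t w, β (π t • w) = t • β w)
    (hβ_range : ∀ m, (∀ i ∈ RingHom.ker π, i • m = 0) → m ∈ Set.range β) :
    ∃ δ : ω ≃+ (FrobRoot p e R →ₗ[R] ω),
      ∀ (r : R) (w : ω) (y : FrobRoot p e R), δ (r • w) y = δ w (FrobRoot.root p e R r * y) := by
  have mul_ker : ∀ w h, Ideal.Quotient.mk _ h = β w → ∀ i ∈ RingHom.ker π,
      h * i ∈ J.map (iterateFrobenius A p e) := by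
    intro w h hw i hi
    rw [← Ideal.Quotient.eq_zero_iff_mem, mul_comm, map_mul, hw]
    have := hβ_smul i w
    rw [(RingHom.mem_ker).1 hi, zero_smul, map_zero] at this
    exact this.symm
  have tr_congr : ∀ w h h', Ideal.Quotient.mk _ h = β w → Ideal.Quotient.mk _ h' = β w →
      ∀ t t', π t = π t' →
      Ideal.Quotient.mk J (𝒯.tr (h * t)) = Ideal.Quotient.mk J (𝒯.tr (h' * t')) := by
    intro w h h' hw hw' t t' ht
    rw [Ideal.Quotient.eq, ← map_sub]
    apply 𝒯.tr_mem_of_mem_map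
    have h1 : h - h' ∈ J.map (iterateFrobenius A p e) := by
      rw [← Ideal.Quotient.eq, hw, hw']
    have h2 := mul_ker w h' hw' (t - t') (by rw [RingHom.mem_ker, map_sub, ht, sub_self])
    have : h * t - h' * t' = (h - h') * t + h' * (t - t') := by ring
    rw [this]
    exact Ideal.add_mem _ (Ideal.mul_mem_right _ _ h1) h2
  -- The pairing is tr(h t) mod J, with h lifting β(w) and t lifting y. It is torsion under the
  -- kernel since i tr(h t) = tr(i^q h t) and i h ∈ J^{[q]}.
  have exists_D : ∀ (w : ω) (y : R), ∃ z : ω, ∀ h t, Ideal.Quotient.mk _ h = β w → π t = y →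
      α z = Ideal.Quotient.mk J (𝒯.tr (h * t)) := by
    intro w y
    obtain ⟨h, hw⟩ := Ideal.Quotient.mk_surjective (β w)
    obtain ⟨t, ht⟩ := hπ y
    obtain ⟨z, hz⟩ := hα_range (Ideal.Quotient.mk J (𝒯.tr (h * t))) (by
      intro i hi
      change Ideal.Quotient.mk J (i * 𝒯.tr (h * t)) = 0
      rw [← 𝒯.tr_pow_mul, Ideal.Quotient.eq_zero_iff_mem]
      apply 𝒯.tr_mem_of_mem_map
      obtain ⟨q, hq⟩ := Nat.exists_eq_add_one_of_ne_zero (pow_pos (expChar_pos A p) e).ne'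
      have := mul_ker w h hw i hi
      have h1 : i ^ p ^ e * (h * t) = (h * i) * (i ^ q * t) := by rw [hq]; ring
      rw [h1]
      exact Ideal.mul_mem_right _ _ this)
    exact ⟨z, fun h' t' hw' ht' => hz.trans (tr_congr w h h' hw hw' t t' (ht.trans ht'.symm))⟩
  choose D hD using exists_D
  have D_add_left : ∀ w w' y, D (w + w') y = D w y + D w' y := by
    intro w w' y
    obtain ⟨h, hw⟩ := Ideal.Quotient.mk_surjective (β w)
    obtain ⟨h', hw'⟩ := Ideal.Quotient.mk_surjective (β w')
    obtain ⟨t, ht⟩ := hπ y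
    apply hα
    rw [map_add, hD w y h t hw ht, hD w' y h' t hw' ht,
      hD (w + w') y (h + h') t (by rw [map_add, map_add, hw, hw']) ht, add_mul, map_add, map_add]
  have D_add_right : ∀ w y y', D w (y + y') = D w y + D w y' := by
    intro w y y'
    obtain ⟨h, hw⟩ := Ideal.Quotient.mk_surjective (β w)
    obtain ⟨t, ht⟩ := hπ y
    obtain ⟨t', ht'⟩ := hπ y'
    apply hα
    rw [map_add, hD w y h t hw ht, hD w y' h t' hw ht',
      hD w (y + y') h (t + t') hw (by rw [map_add, ht, ht']), mul_add, map_add, map_add]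
  have D_smul_right : ∀ r w y, D w (r ^ p ^ e * y) = r • D w y := by
    intro r w y
    obtain ⟨h, hw⟩ := Ideal.Quotient.mk_surjective (β w)
    obtain ⟨t, ht⟩ := hπ y
    obtain ⟨s, rfl⟩ := hπ r
    apply hα
    rw [hα_smul, hD w y h t hw ht,
      hD w _ h (s ^ p ^ e * t) hw (by rw [map_mul, map_pow, ht]), mul_left_comm, 𝒯.tr_pow_mul,
      map_mul]
    rfl
  have D_smul_left : ∀ r w y, D (r • w) y = D w (r * y) := by
    intro r w y
    obtain ⟨h, hw⟩ := Ideal.Quotient.mk_surjective (β w)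
    obtain ⟨t, ht⟩ := hπ y
    obtain ⟨s, rfl⟩ := hπ r
    apply hα
    rw [hD w _ h (s * t) hw (by rw [map_mul, ht]),
      hD (π s • w) y (s * h) t (by rw [hβ_smul, ← hw]; rfl) ht, mul_left_comm, mul_assoc]
  let δ : ω →+ (FrobRoot p e R →ₗ[R] ω) := AddMonoidHom.mk' (fun w =>
    { toFun := fun y => D w ((FrobRoot.root p e R).symm y)
      map_add' := fun y y' => by rw [map_add, D_add_right]
      map_smul' := fun r y => by
        obtain ⟨y, rfl⟩ := (FrobRoot.root p e R).surjective y
        rw [FrobRoot.smul_root, RingEquiv.symm_apply_apply, RingEquiv.symm_apply_apply,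
          D_smul_right, RingHom.id_apply] })
    (fun w w' => by ext y; exact D_add_left w w' _)
  have hδ : ∀ w y, δ w (FrobRoot.root p e R y) = D w y := fun w y => rfl
  refine ⟨AddEquiv.ofBijective δ ⟨?_, ?_⟩, ?_⟩
  · rw [injective_iff_map_eq_zero]
    intro w hw
    obtain ⟨h, hh⟩ := Ideal.Quotient.mk_surjective (β w)
    apply hβ
    rw [map_zero, ← hh, Ideal.Quotient.eq_zero_iff_mem]
    apply 𝒯.mem_map_of_tr_mem
    intro t
    rw [← Ideal.Quotient.eq_zero_iff_mem, ← hD w (π t) h t hh rfl, ← hδ, hw]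
    simp
  · intro φ
    let ψ : A →+ A ⧸ J := α.comp (φ.toAddMonoidHom.comp
      ((FrobRoot.root p e R).toAddMonoidHom.comp π.toAddMonoidHom))
    have hψ : ∀ t, ψ t = α (φ (FrobRoot.root p e R (π t))) := fun t => rfl
    obtain ⟨h, hh⟩ := 𝒯.exists_eq_mk_tr J ψ (by
      intro t f
      rw [hψ, hψ, map_mul, map_pow, ← FrobRoot.smul_root, map_smul, hα_smul])
    -- As φ is defined on R^{1/q}, tr(i h t) is zero modulo J for all t and all i in the kernel, so
    -- h is torsion modulo J^{[q]}.
    obtain ⟨w, hw⟩ := hβ_range (Ideal.Quotient.mk _ h) (by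
      intro i hi
      change Ideal.Quotient.mk _ (i * h) = 0
      rw [Ideal.Quotient.eq_zero_iff_mem]
      apply 𝒯.mem_map_of_tr_mem
      intro t
      rw [← Ideal.Quotient.eq_zero_iff_mem, mul_comm i h, mul_assoc, ← hh, hψ, map_mul,
        (RingHom.mem_ker).1 hi]
      simp)
    refine ⟨w, ?_⟩
    ext y
    obtain ⟨y, rfl⟩ := (FrobRoot.root p e R).surjective y
    obtain ⟨t, rfl⟩ := hπ y
    apply hα
    rw [hδ, hD w _ h t hw.symm rfl, ← hh, hψ]
  · intro r w y
    obtain ⟨y, rfl⟩ := (FrobRoot.root p e R).surjective y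
    change δ (r • w) _ = δ w _
    rw [← map_mul, hδ, hδ, D_smul_left]

end FrobeniusTrace

/-! ### The canonical module and the dual of Frobenius -/

namespace EssFinPresentation

variable {k R : Type u} [Field k] [CommRing R] [Algebra k R] (P : EssFinPresentation k R)

instance : IsNoetherianRing P.Ambient :=
  IsLocalization.isNoetherianRing P.units P.Ambient inferInstance

theorem isNoetherianRing (P : EssFinPresentation k R) : IsNoetherianRing R :=
  isNoetherianRing_of_surjective _ _ P.ambientHom P.ambientHom_surjective

theorem annihilator_eq_ker : Module.annihilator P.Ambient R = RingHom.ker P.ambientHom := by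
  ext r
  rw [Module.mem_annihilator, RingHom.mem_ker]
  refine ⟨fun h => ?_, fun h x => ?_⟩
  · have := h 1
    rwa [Algebra.smul_def, mul_one] at this
  · rw [Algebra.smul_def]
    exact (congrArg (· * x) h).trans (zero_mul x)

/-- `Ext^i_T(R, T)` in terms of a regular sequence of length `i` in the kernel of `T → R`. -/
theorem exists_extAmbient_addMonoidHom (rs : List P.Ambient)
    (hrs : ∀ r ∈ rs, r ∈ RingHom.ker P.ambientHom)
    (reg : RingTheory.Sequence.IsWeaklyRegular P.Ambient rs) {i : ℕ} (hi : rs.length = i)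
    {J : Ideal P.Ambient} (hJ : Ideal.ofList rs = J) :
    ∃ α : P.ExtAmbient i →+ P.Ambient ⧸ J, Function.Injective α ∧
      (∀ t w, α (P.ambientHom t • w) = t • α w) ∧
      ∀ m, (∀ i ∈ RingHom.ker P.ambientHom, i • m = 0) → m ∈ Set.range α := by
  subst hi hJ
  obtain ⟨α, hα, hα'⟩ := exists_ext_linearMap_of_isWeaklyRegular (T := P.Ambient) (R := R)
    P.ambientHom_surjective P.Ambient rs hrs reg
  have hJ : (Ideal.ofList rs • ⊤ : Submodule P.Ambient P.Ambient) = Ideal.ofList rs := by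
    rw [smul_eq_mul, Ideal.mul_top]
  let E := Submodule.quotEquivOfEq _ _ hJ
  refine ⟨(E.toLinearMap ∘ₗ α).toAddMonoidHom, E.injective.comp hα, fun t w => ?_, fun m hm => ?_⟩
  -- The action through the first variable agrees with the T-linear structure of Ext.
  · have h : ∀ w : Abelian.Ext.{u} (ModuleCat.of P.Ambient R) (ModuleCat.of P.Ambient P.Ambient)
        rs.length, P.extAction _ (P.ambientHom t) w = t • w := by
      intro w
      have h1 : P.mulEnd (P.ambientHom t) = t • 𝟙 _ := by
        ext x
        simp only [mulEnd, ModuleCat.hom_ofHom]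
        exact (Algebra.smul_def t x).symm
      change (Abelian.Ext.mk₀ (P.mulEnd (P.ambientHom t))).comp _ (zero_add _) = _
      rw [h1, Abelian.Ext.mk₀_smul, Abelian.Ext.smul_comp, Abelian.Ext.mk₀_id_comp]
    exact (congrArg (E.toLinearMap ∘ₗ α) (h w)).trans (map_smul (E.toLinearMap ∘ₗ α) t _)
  · obtain ⟨w, hw⟩ := hα' (E.symm m) (fun i hi => by rw [← map_smul, hm i hi, map_zero])
    refine ⟨w, ?_⟩
    change E (α w) = m
    rw [hw, LinearEquiv.apply_symm_apply]

variable {p : ℕ} [ExpChar R p]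

theorem expChar_base [Nontrivial R] : ExpChar k p :=
  (algebraMap k R).expChar (algebraMap k R).injective p

theorem expChar_ambient [Nontrivial R] : ExpChar P.Ambient p := by
  have : ExpChar k p := expChar_base (R := R)
  have : Nontrivial P.Ambient := P.ambientHom.domain_nontrivial
  let f : k →+* P.Ambient := (algebraMap (MvPolynomial (Fin P.n) k) P.Ambient).comp MvPolynomial.C
  exact expChar_of_injective_ringHom f.injective p

/-- The trace of the `e`-th iterate of Frobenius on the ambient ring of a presentation over a
perfect field. -/
theorem nonempty_frobeniusTrace [PerfectField k] [Nontrivial R] (e : ℕ) :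
    Nonempty (FrobeniusTrace (p ^ e) P.Ambient) := by
  have : ExpChar k p := expChar_base (R := R)
  exact ⟨(FrobeniusTrace.mvPolynomial p e P.n k).localization P.units P.Ambient
    (pow_pos (expChar_pos k p) e).ne'⟩

theorem finite_frobRoot (P : EssFinPresentation k R) [PerfectField k] [Nontrivial R] (e : ℕ) :
    Module.Finite R (FrobRoot p e R) := by
  obtain ⟨𝒯⟩ := P.nonempty_frobeniusTrace (p := p) e
  have := P.expChar_ambient (p := p)
  exact 𝒯.finite_frobRoot_of_surjective _ P.ambientHom_surjective

theorem exists_isFrobeniusDual [PerfectField k] [IsLocalRing R] (hR : P.IsGorensteinLocal)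
    (e : ℕ) : ∃ Φ : FrobRoot p e R →ₗ[R] R, P.IsFrobeniusDual Φ := by
  obtain ⟨hCM, ⟨u⟩⟩ := hR
  obtain ⟨𝒯⟩ := P.nonempty_frobeniusTrace (p := p) e
  have := P.expChar_ambient (p := p)
  have hfin : Module.Finite P.Ambient R :=
    Module.Finite.of_surjective (Algebra.linearMap P.Ambient R) P.ambientHom_surjective
  have hker : RingHom.ker P.ambientHom ≠ ⊤ := RingHom.ker_ne_top _
  -- Only vanishing below the codimension is used: it bounds from below the depth of T along the
  -- kernel.
  obtain ⟨rs, hlen, hmem, hreg⟩ := ModuleCat.exists_isRegular_of_exists_subsingleton_ext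
    (RingHom.ker P.ambientHom) P.codim (ModuleCat.of P.Ambient P.Ambient)
    (by rw [smul_eq_mul, Ideal.mul_top]; exact hker.lt_top)
    (ModuleCat.of P.Ambient R)
    (by
      change Module.support P.Ambient R = _
      rw [Module.support_eq_zeroLocus, P.annihilator_eq_ker])
    (fun i hi => hCM i hi.ne)
  have hreg1 : RingTheory.Sequence.IsWeaklyRegular P.Ambient rs := hreg.toIsWeaklyRegular
  obtain ⟨α, hα, hα_smul, hα_range⟩ := P.exists_extAmbient_addMonoidHom rs hmem hreg1 hlen rfl
  -- The same Ext module, computed with the q-th powers of the sequence.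
  obtain ⟨β, hβ, hβ_smul, hβ_range⟩ := P.exists_extAmbient_addMonoidHom
    (rs.map (iterateFrobenius P.Ambient p e))
    (by
      intro r hr
      obtain ⟨s, hs, rfl⟩ := List.mem_map.1 hr
      rw [RingHom.mem_ker, iterateFrobenius_def, map_pow, (RingHom.mem_ker).1 (hmem s hs),
        zero_pow (pow_pos (expChar_pos R p) e).ne'])
    (𝒯.isWeaklyRegular_map_iterateFrobenius hreg1) (by simpa using hlen)
    (Ideal.map_ofList (iterateFrobenius P.Ambient p e) rs).symm
  obtain ⟨δ, hδ⟩ := 𝒯.exists_addEquiv_linearMap P.ambientHom P.ambientHom_surjective _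
    α hα hα_smul hα_range β hβ hβ_smul hβ_range
  -- R^{1/q}-linearity of `δ` gives δ(u⁻¹ x)(1) = δ(u⁻¹ 1)(x^{1/q}).
  refine ⟨u.toLinearMap ∘ₗ δ (u.symm 1), u, δ, hδ, fun x => ?_⟩
  have : u.symm x = x • u.symm 1 := by rw [← map_smul, smul_eq_mul, mul_one]
  rw [this, hδ, mul_one]
  rfl

/-- A map dual to Frobenius generates `Hom_R(R^{1/p^e}, R)`. -/
theorem IsFrobeniusDual.exists_eq_mul {P : EssFinPresentation k R} {e : ℕ}
    {Φ : FrobRoot p e R →ₗ[R] R} (h : P.IsFrobeniusDual Φ) (φ : FrobRoot p e R →ₗ[R] R) :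
    ∃ a : R, ∀ y, φ y = Φ (FrobRoot.root p e R a * y) := by
  obtain ⟨u, δ, hδ, hΦ⟩ := h
  obtain ⟨w, hw⟩ := δ.surjective (u.symm.toLinearMap ∘ₗ φ)
  refine ⟨u w, fun y => ?_⟩
  obtain ⟨y, rfl⟩ := (FrobRoot.root p e R).surjective y
  have h1 : u.symm (u w * y) = y • w := by
    rw [mul_comm, ← smul_eq_mul, map_smul, LinearEquiv.symm_apply_apply]
  rw [← map_mul, hΦ, h1, hδ, mul_one, hw]
  simp

end EssFinPresentation

/-! ### Two facts about domains -/

/-- Finite modules over a domain become free, up to multiplication by a nonzero element. -/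
theorem Module.Finite.exists_smul_eq_sum (A F : Type*) [CommRing A] [IsDomain A] [AddCommGroup F]
    [Module A F] [Module.Finite A F] :
    ∃ c : A, c ≠ 0 ∧ ∃ (n : ℕ) (g : Fin n → F) (l : Fin n → F →ₗ[A] A),
      ∀ y, c • y = ∑ i, l i y • g i := by
  classical
  obtain ⟨m, v, hv⟩ := Module.Finite.exists_fin (R := A) (M := F)
  obtain ⟨s, hs, hs'⟩ := exists_maximal_linearIndepOn A v
  have hs'' : ∀ i, ∃ a : A, a ≠ 0 ∧ a • v i ∈ Submodule.span A (v '' s) := by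
    intro i
    by_cases hi : i ∈ s
    · exact ⟨1, one_ne_zero, by rw [one_smul]; exact Submodule.subset_span ⟨i, hi, rfl⟩⟩
    · exact hs' i hi
  choose a ha ha' using hs''
  -- The product clears the denominators of all generators simultaneously.
  have hc : ∀ y : F, (∏ i, a i) • y ∈ Submodule.span A (v '' s) := by
    intro y
    have hy : y ∈ Submodule.span A (Set.range v) := by rw [hv]; trivial
    induction hy using Submodule.span_induction with
    | mem x hx =>
      obtain ⟨i, rfl⟩ := hx
      rw [← Finset.prod_erase_mul _ _ (Finset.mem_univ i), mul_smul]
      exact Submodule.smul_mem _ _ (ha' i)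
    | zero => simp
    | add x y _ _ hx hy => rw [smul_add]; exact Submodule.add_mem _ hx hy
    | smul t x _ hx => rw [smul_comm]; exact Submodule.smul_mem _ _ hx
  have hli : LinearIndependent A (fun i : s => v i) := hs
  have hrange : Set.range (fun i : s => v i) = v '' s := by
    rw [← Set.image_eq_range]
  let N := Submodule.span A (Set.range (fun i : s => v i))
  let b : Module.Basis s A N := Module.Basis.span hli
  let f : F →ₗ[A] N := LinearMap.codRestrict N (LinearMap.lsmul A F (∏ i, a i))
    (fun y => by rw [← hrange] at hc; exact hc y)
  let E : Fin (Fintype.card s) ≃ s := (Fintype.equivFin s).symm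
  refine ⟨∏ i, a i, Finset.prod_ne_zero_iff.2 (fun i _ => ha i), Fintype.card s,
    fun i => v (E i), fun i => (b.coord (E i)).comp f, fun y => ?_⟩
  have h1 : ∑ i, b.repr (f y) i • b i = f y := b.sum_repr (f y)
  have h2 := congrArg (Subtype.val) h1
  rw [Submodule.coe_sum] at h2
  have h3 : ((f y : N) : F) = (∏ i, a i) • y := rfl
  rw [← h3, ← h2, ← E.sum_comp]
  refine Finset.sum_congr rfl fun i _ => ?_
  have h4 : ((b (E i) : N) : F) = v (E i) :=
    congrArg Subtype.val (Module.Basis.span_apply hli (E i))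
  rw [Submodule.coe_smul, h4]
  rfl

/-- If `c J ⊆ J²` for a nonzero ideal `J` of a noetherian domain, then `J` contains a power
of `c`. -/
theorem Ideal.exists_pow_mem_of_forall_mul_mem_sq {A : Type*} [CommRing A] [IsDomain A]
    [IsNoetherianRing A] {J : Ideal A} (hJ : J ≠ ⊥) {c : A} (hc : ∀ y ∈ J, c * y ∈ J ^ 2) :
    ∃ n, c ^ n ∈ J := by
  let f : Module.End A J := LinearMap.lsmul A J c
  -- Cayley–Hamilton for multiplication by c, which maps J into J · J: all nonleading coefficients
  -- of `P` lie in J, and P(c) kills J.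
  obtain ⟨P, hP, -, hcoeff, hP0⟩ :=
    LinearMap.exists_monic_and_natDegree_eq_and_coeff_mem_pow_and_aeval_eq_zero
      A f J (by
      rintro _ ⟨y, rfl⟩
      have h := hc y y.2
      have hmap : Submodule.map J.subtype (J • ⊤) = J ^ 2 := by
        rw [Submodule.map_smul'', Submodule.map_top, Submodule.range_subtype, smul_eq_mul, sq]
      rw [← hmap] at h
      obtain ⟨z, hz, hzy⟩ := h
      rwa [show f y = z from Subtype.ext hzy.symm])
  have hf : f = algebraMap A (Module.End A J) c := rfl
  rw [hf, Polynomial.aeval_algebraMap_apply] at hP0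
  obtain ⟨b, hb, hb0⟩ := (Submodule.ne_bot_iff J).1 hJ
  have h0 : P.eval c = 0 := by
    have h1 := congrArg (fun g : Module.End A J => ((g ⟨b, hb⟩ : J) : A)) hP0
    have h2 : P.eval c * b = 0 := by simpa [Polynomial.aeval_def] using h1
    exact (mul_eq_zero.1 h2).resolve_right hb0
  refine ⟨P.natDegree, ?_⟩
  rw [Polynomial.eval_eq_sum_range, Finset.sum_range_succ, hP.coeff_natDegree, one_mul] at h0
  rw [eq_neg_of_add_eq_zero_right h0]
  refine J.neg_mem (J.sum_mem fun i hi => J.mul_mem_right _ ?_)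
  exact Ideal.pow_le_self (Nat.sub_ne_zero_of_lt (Finset.mem_range.1 hi)) (hcoeff i)

/-! ### Generators of p^{-e}-linear maps and test ideals -/

section FrobLinear

variable {R : Type u} [CommRing R]

/-- `φ` is `p^{-e}`-linear: it is an `R`-linear map `R^{1/p^e} → R`, seen as an endomorphism
of the additive group of `R`. -/
def IsFrobLinear (p e : ℕ) (φ : AddMonoid.End R) : Prop :=
  ∀ r y, φ (r ^ p ^ e * y) = r * φ y

/-- `Φ` is a free generator of the `R^{1/p^e}`-module `Hom_R(R^{1/p^e}, R)`. -/
structure IsFrobGenerator (p e : ℕ) (Φ : AddMonoid.End R) : Prop where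
  isFrobLinear : IsFrobLinear p e Φ
  exists_eq : ∀ φ, IsFrobLinear p e φ → ∃ a, ∀ y, φ y = Φ (a * y)
  eq_zero : ∀ a, (∀ y, Φ (a * y) = 0) → a = 0

theorem IsFrobLinear.mul {p e d : ℕ} {φ ψ : AddMonoid.End R} (hφ : IsFrobLinear p e φ)
    (hψ : IsFrobLinear p d ψ) : IsFrobLinear p (e + d) (φ * ψ) := by
  intro r y
  change φ (ψ _) = r * φ (ψ y)
  rw [pow_add, pow_mul, hψ, hφ]

/-- For fixed y, z ↦ φ(z^{p^d} y) has level e, hence equals Φ(θ(y) z). Uniqueness of θ(y) makes θ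
p^{-d}-linear, so θ = Ψ(a ·), and z = 1 gives φ = ΦΨ(a ·). -/
theorem IsFrobGenerator.mul {p e d : ℕ} [ExpChar R p] {Φ Ψ : AddMonoid.End R}
    (hΦ : IsFrobGenerator p e Φ) (hΨ : IsFrobGenerator p d Ψ) :
    IsFrobGenerator p (e + d) (Φ * Ψ) := by
  have inj : ∀ a b, (∀ z, Φ (a * z) = Φ (b * z)) → a = b := by
    intro a b h
    rw [← sub_eq_zero]
    exact hΦ.eq_zero _ fun y => by rw [sub_mul, map_sub, h, sub_self]
  refine ⟨hΦ.isFrobLinear.mul hΨ.isFrobLinear, fun φ hφ => ?_, fun a ha => ?_⟩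
  · have hex : ∀ y, ∃ a, ∀ z, φ (z ^ p ^ d * y) = Φ (a * z) := by
      intro y
      refine hΦ.exists_eq (φ.comp ((AddMonoidHom.mulRight y).comp
        (iterateFrobenius R p d).toAddMonoidHom)) ?_
      intro r z
      change φ ((r ^ p ^ e * z) ^ p ^ d * y) = r * φ (z ^ p ^ d * y)
      rw [← hφ, pow_add, pow_mul, mul_pow, mul_assoc]
    choose θ hθ using hex
    obtain ⟨a, ha⟩ := hΨ.exists_eq (AddMonoidHom.mk' θ (by
      intro y y'
      apply inj
      intro z
      rw [← hθ, mul_add, map_add, hθ, hθ, add_mul, map_add])) (by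
      intro r y
      apply inj
      intro z
      change Φ (θ _ * z) = Φ (r * θ y * z)
      have h1 : r * θ y * z = θ y * (r * z) := by ring
      rw [← hθ, h1, ← hθ, mul_pow]
      congr 1
      ring)
    refine ⟨a, fun y => ?_⟩
    change φ y = Φ (Ψ (a * y))
    rw [← ha]
    have h1 := hθ y 1
    rw [one_pow, one_mul, mul_one] at h1
    exact h1
  · apply hΨ.eq_zero
    intro y
    apply hΦ.eq_zero
    intro z
    rw [mul_comm, ← hΨ.isFrobLinear, mul_left_comm]
    exact ha _

theorem isFrobGenerator_one (p : ℕ) : IsFrobGenerator p 0 (1 : AddMonoid.End R) := by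
  refine ⟨fun r y => by simp, fun φ hφ => ⟨φ 1, fun y => ?_⟩, fun a ha => by simpa using ha 1⟩
  have := hφ y 1
  simpa [mul_comm] using this

theorem IsFrobGenerator.pow {p e : ℕ} [ExpChar R p] {Φ : AddMonoid.End R}
    (hΦ : IsFrobGenerator p e Φ) (n : ℕ) : IsFrobGenerator p (e * n) (Φ ^ n) := by
  induction n with
  | zero => exact isFrobGenerator_one p
  | succ n ih => rw [pow_succ, mul_add, mul_one]; exact ih.mul hΦ

theorem IsFrobGenerator.mem_of_forall_mem {p e : ℕ} {Φ φ : AddMonoid.End R}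
    (hΦ : IsFrobGenerator p e Φ) (hφ : IsFrobLinear p e φ) {J : Ideal R} {S : Set R}
    (h : ∀ y ∈ J, Φ y ∈ S) : ∀ y ∈ J, φ y ∈ S := by
  obtain ⟨a, ha⟩ := hΦ.exists_eq φ hφ
  intro y hy
  rw [ha]
  exact h _ (J.mul_mem_left _ hy)

/-- The image of an ideal under a `p^{-e}`-linear map. -/
def IsFrobLinear.image {p e : ℕ} {φ : AddMonoid.End R} (hφ : IsFrobLinear p e φ) (J : Ideal R) :
    Ideal R where
  carrier := φ '' J
  add_mem' := by
    rintro _ _ ⟨x, hx, rfl⟩ ⟨y, hy, rfl⟩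
    exact ⟨x + y, J.add_mem hx hy, map_add _ _ _⟩
  zero_mem' := ⟨0, J.zero_mem, map_zero _⟩
  smul_mem' := by
    rintro r _ ⟨x, hx, rfl⟩
    exact ⟨r ^ p ^ e * x, J.mul_mem_left _ hx, hφ r x⟩

/-- Uniform test elements: over an `F`-finite noetherian domain there is a smallest nonzero ideal
compatible with a given generator. -/
theorem IsFrobGenerator.exists_isLeast {p e : ℕ} [ExpChar R p] [IsDomain R] [IsNoetherianRing R]
    [Module.Finite R (FrobRoot p e R)] (hq : 1 < p ^ e) {Φ : AddMonoid.End R}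
    (hΦ : IsFrobGenerator p e Φ) :
    ∃ J : Ideal R, IsLeast {I : Ideal R | I ≠ ⊥ ∧ ∀ y ∈ I, Φ y ∈ I} J := by
  obtain ⟨c, hc, n, g, l, hl⟩ := Module.Finite.exists_smul_eq_sum R (FrobRoot p e R)
  obtain ⟨b, hb⟩ : ∃ b, Φ b ≠ 0 := by
    by_contra! h
    exact one_ne_zero (hΦ.eq_zero 1 fun y => h _)
  let t := c * Φ b
  have ht : t ≠ 0 := mul_ne_zero hc hb
  have hmem : ∀ I : Ideal R, I ≠ ⊥ → (∀ y ∈ I, Φ y ∈ I) → t ^ 3 ∈ I := by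
    intro I hI hI'
    obtain ⟨m, hm⟩ : ∃ m, t ^ m ∈ I := by
      -- For y ∈ I, c^q y is a combination of q-th powers of elements l_i(y) ∈ I, and q ≥ 2 puts
      -- these in I².
      obtain ⟨m, hm⟩ := Ideal.exists_pow_mem_of_forall_mul_mem_sq hI (c := c ^ p ^ e) (by
        intro y hy
        have h1 := congrArg (FrobRoot.root p e R).symm (hl (FrobRoot.root p e R y))
        rw [FrobRoot.smul_root, RingEquiv.symm_apply_apply, map_sum] at h1
        rw [h1]
        refine Ideal.sum_mem _ fun i _ => ?_
        obtain ⟨z, hz⟩ := (FrobRoot.root p e R).surjective (g i)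
        rw [← hz, FrobRoot.smul_root, RingEquiv.symm_apply_apply]
        refine Ideal.mul_mem_right _ _ (Ideal.pow_le_pow_right hq ?_)
        refine Ideal.pow_mem_pow ?_ _
        refine hΦ.mem_of_forall_mem
          (φ := (l i).toAddMonoidHom.comp (FrobRoot.root p e R).toAddMonoidHom) ?_ hI' y hy
        intro r z
        change l i (FrobRoot.root p e R (r ^ p ^ e * z)) = r * l i (FrobRoot.root p e R z)
        rw [← FrobRoot.smul_root, map_smul, smul_eq_mul])
      refine ⟨p ^ e * m, ?_⟩
      rw [mul_pow, pow_mul]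
      exact I.mul_mem_right _ hm
    -- With j = ⌈m/2⌉ one has qj ≥ m and Φ(t^{qj} c^q b) = t^j c Φ(b) = t^{j+1}. The exponent drops
    -- as long as m ≥ 4, whence the uniform bound 3.
    induction m using Nat.strong_induction_on with
    | _ m ih =>
      rcases Nat.lt_or_ge m 4 with h4 | h4
      · exact Ideal.pow_mem_of_pow_mem _ hm (by omega)
      · refine ih ((m + 1) / 2 + 1) (by omega) ?_
        have h2 : m ≤ p ^ e * ((m + 1) / 2) :=
          le_trans (by omega) (Nat.mul_le_mul_right ((m + 1) / 2) hq)
        have h3 := hI' (t ^ (p ^ e * ((m + 1) / 2)) * (c ^ p ^ e * b))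
          (I.mul_mem_right _ (Ideal.pow_mem_of_pow_mem _ hm h2))
        rw [mul_comm (p ^ e), pow_mul, hΦ.isFrobLinear, hΦ.isFrobLinear] at h3
        rwa [pow_succ]
  refine ⟨sInf {I : Ideal R | I ≠ ⊥ ∧ ∀ y ∈ I, Φ y ∈ I}, ⟨?_, ?_⟩, fun I hI => sInf_le hI⟩
  · intro h
    apply pow_ne_zero 3 ht
    rw [← Ideal.mem_bot, ← h, Submodule.mem_sInf]
    exact fun I hI => hmem I hI.1 hI.2
  · intro y hy
    rw [Submodule.mem_sInf] at hy ⊢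
    exact fun I hI => hI.2 y (hy I hI)

/-- The smallest nonzero ideal compatible with a generator of `Hom(R^{1/p^e}, R)` is compatible with
the generators of `Hom(R^{1/p^d}, R)`. -/
theorem IsFrobGenerator.mem_of_isLeast {p e d : ℕ} [ExpChar R p] [IsDomain R] (he : 0 < e)
    {Φ Ψ : AddMonoid.End R} (hΦ : IsFrobGenerator p e Φ) (hΨ : IsFrobGenerator p d Ψ)
    {J : Ideal R} (hJ : IsLeast {I : Ideal R | I ≠ ⊥ ∧ ∀ y ∈ I, Φ y ∈ I} J) :
    ∀ y ∈ J, Ψ y ∈ J := by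
  -- Minimality applies to Ψ(J): it is nonzero as Ψ is a free generator, and Φ-compatible as ΦΨ is a
  -- multiple of the generator ΨΦ.
  have hle : J ≤ hΨ.isFrobLinear.image J := by
    refine hJ.2 ⟨?_, ?_⟩
    · obtain ⟨⟨b, hb⟩, hb0⟩ : ∃ b : J, b ≠ 0 := by
        have := (Submodule.ne_bot_iff J).1 hJ.1.1
        obtain ⟨b, hb, hb0⟩ := this
        exact ⟨⟨b, hb⟩, fun h => hb0 (congrArg Subtype.val h)⟩
      intro h
      apply hb0
      ext
      refine hΨ.eq_zero b fun y => ?_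
      have : Ψ (b * y) ∈ hΨ.isFrobLinear.image J := ⟨_, J.mul_mem_right _ hb, rfl⟩
      rwa [h] at this
    · rintro _ ⟨y, hy, rfl⟩
      refine IsFrobGenerator.mem_of_forall_mem (hΨ.mul hΦ) (φ := Φ * Ψ) (J := J)
        (S := hΨ.isFrobLinear.image J) ?_ ?_ y hy
      · rw [add_comm]; exact hΦ.isFrobLinear.mul hΨ.isFrobLinear
      · intro z hz
        exact ⟨Φ z, hJ.1.2 z hz, rfl⟩
  have hpow : ∀ n, ∀ y ∈ J, ∃ z ∈ J, (Ψ ^ n) z = y := by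
    intro n
    induction n with
    | zero => exact fun y hy => ⟨y, hy, rfl⟩
    | succ n ih =>
      intro y hy
      obtain ⟨z, hz, rfl⟩ := ih y hy
      obtain ⟨w, hw, rfl⟩ := hle hz
      exact ⟨w, hw, by rw [pow_succ]; rfl⟩
  have hΦpow : ∀ n, ∀ y ∈ J, (Φ ^ n) y ∈ J := by
    intro n
    induction n with
    | zero => exact fun y hy => hy
    | succ n ih =>
      intro y hy
      rw [pow_succ]
      exact ih _ (hJ.1.2 y hy)
  intro y hy
  -- Writing y = Ψ^{e-1}(z) turns Ψ(y) into Ψ^e(z), whose level de is that of Φ^d.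
  obtain ⟨z, hz, rfl⟩ := hpow (e - 1) y hy
  have h1 : Ψ ((Ψ ^ (e - 1)) z) = (Ψ ^ e) z := by
    conv_rhs => rw [← Nat.sub_add_cancel he, pow_succ']
    rfl
  rw [h1]
  refine (hΦ.pow d).mem_of_forall_mem (S := J) ?_ (hΦpow d) z hz
  rw [mul_comm]
  exact (hΨ.pow e).isFrobLinear

variable {p e : ℕ} [ExpChar R p]

/-- An `R`-linear map `R^{1/p^e} → R` as an endomorphism of the additive group of `R`. -/
noncomputable def FrobRoot.toEnd (φ : FrobRoot p e R →ₗ[R] R) : AddMonoid.End R :=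
  φ.toAddMonoidHom.comp (FrobRoot.root p e R).toAddMonoidHom

theorem FrobRoot.toEnd_apply (φ : FrobRoot p e R →ₗ[R] R) (y : R) :
    FrobRoot.toEnd φ y = φ (FrobRoot.root p e R y) := rfl

theorem FrobRoot.isFrobLinear_toEnd (φ : FrobRoot p e R →ₗ[R] R) :
    IsFrobLinear p e (FrobRoot.toEnd φ) := by
  intro r y
  rw [FrobRoot.toEnd_apply, ← FrobRoot.smul_root, map_smul]
  rfl

theorem isFrobCompatible_iff (φ : FrobRoot p e R →ₗ[R] R) (J : Ideal R) :
    IsFrobCompatible φ J ↔ ∀ y ∈ J, FrobRoot.toEnd φ y ∈ J := by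
  refine ⟨fun h y hy => h _ (Ideal.mem_map_of_mem _ hy), fun h y hy => ?_⟩
  obtain ⟨z, hz, rfl⟩ := (Ideal.mem_map_iff_of_surjective _ (FrobRoot.root p e R).surjective).1 hy
  exact h z hz

end FrobLinear

/-! ### Conclusion -/

theorem EssFinPresentation.IsFrobeniusDual.isFrobGenerator {k R : Type u} [Field k] [CommRing R]
    [Algebra k R] {p e : ℕ} [ExpChar R p] {P : EssFinPresentation k R}
    {Φ : FrobRoot p e R →ₗ[R] R} (h : P.IsFrobeniusDual Φ) :
    IsFrobGenerator p e (FrobRoot.toEnd Φ) := by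
  refine ⟨FrobRoot.isFrobLinear_toEnd Φ, fun φ hφ => ?_, fun a ha => ?_⟩
  · obtain ⟨a, ha⟩ := h.exists_eq_mul
      { toFun := fun y => φ ((FrobRoot.root p e R).symm y)
        map_add' := fun y z => by simp
        map_smul' := fun r y => by
          obtain ⟨y, rfl⟩ := (FrobRoot.root p e R).surjective y
          rw [FrobRoot.smul_root, RingEquiv.symm_apply_apply, RingEquiv.symm_apply_apply, hφ]
          rfl }
    refine ⟨a, fun y => ?_⟩
    rw [FrobRoot.toEnd_apply, map_mul, ← ha]
    rfl
  · obtain ⟨u, δ, hδ, hΦ⟩ := h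
    have h1 : δ (u.symm a) = 0 := by
      ext y
      obtain ⟨y, rfl⟩ := (FrobRoot.root p e R).surjective y
      apply u.injective
      have h2 := ha y
      have h3 : u.symm (a * y) = y • u.symm a := by rw [mul_comm, ← smul_eq_mul, map_smul]
      rw [FrobRoot.toEnd_apply, hΦ, h3, hδ, mul_one] at h2
      rw [h2]
      simp
    simpa using h1

theorem mainTheorem4 (p : ℕ) [Fact p.Prime] (k R : Type u) [Field k] [PerfectField k]
    [CommRing R] [IsDomain R] [IsLocalRing R] [Algebra k R] [CharP R p]
    (P : EssFinPresentation k R) (hR : P.IsGorensteinLocal) (e : ℕ) (he : 0 < e) :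
    (∃ Φ : FrobRoot p e R →ₗ[R] R, P.IsFrobeniusDual Φ) ∧
    ∀ Φ : FrobRoot p e R →ₗ[R] R, P.IsFrobeniusDual Φ →
      ∃ τ : Ideal R, IsTestIdeal p τ ∧ IsTestIdealOfMap Φ τ := by
  refine ⟨P.exists_isFrobeniusDual hR e, fun Φ hΦ => ?_⟩
  have := P.isNoetherianRing
  have := P.finite_frobRoot (p := p) e
  obtain ⟨τ, hτ⟩ := hΦ.isFrobGenerator.exists_isLeast
    (Nat.one_lt_pow he.ne' (Fact.out : p.Prime).one_lt)
  refine ⟨τ, ⟨⟨hτ.1.1, fun d _ φ => ?_⟩, fun I hI => ?_⟩, ?_⟩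
  -- Every map of level d is a multiple of a dual Ψ of the d-th Frobenius, so compatibility with Ψ
  -- suffices.
  · obtain ⟨Ψ, hΨ⟩ := P.exists_isFrobeniusDual (p := p) hR d
    rw [isFrobCompatible_iff]
    exact hΨ.isFrobGenerator.mem_of_forall_mem (FrobRoot.isFrobLinear_toEnd φ) (S := τ)
      (hΦ.isFrobGenerator.mem_of_isLeast he hΨ.isFrobGenerator hτ)
  · exact hτ.2 ⟨hI.1, (isFrobCompatible_iff Φ I).1 (hI.2 e he Φ)⟩
  · simpa only [IsTestIdealOfMap, isFrobCompatible_iff] using hτ
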